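/- Let $E$ and $F$ be Archimedean vector lattices with locally convex-solid topologies generated by families of Riesz seminorms $(p_\alpha)_{\alpha\in I}$ and $(q_\beta)_{\beta\in J}$ respectively (a seminorm $p$ is a Riesz seminorm if $|x|\le|y|$ implies $p(x)\le p(y)$; no Hausdorff assumption is made). Let $E\overline{\otimes}F$ be the Fremlin tensor product, i.e. the Archimedean vector lattice with a lattice bimorphism $(x,y)\mapsto x\otimes y$ through which every lattice bimorphism of $E\times F$ into an Archimedean vector lattice factors by a unique lattice homomorphism. For $U\subseteq E$, $V\subseteq F$ let $W(U,V)$ be the convex balanced hull $\{\sum_{i=1}^n\lambda_iz_i:\ z_i\in S,\ \sum_i|\lambda_i|\le 1\}$ of the solid hull $S=\{z:\ |z|\le|x\otimes y|\text{ for some }x\in U,\ y\in V\}$, and let $\tau_F$ be the topology on $E\overline{\otimes}F$ in which a set $O$ is open iff for every $z\in O$ there are convex solid zero neighborhoods $U$ of $E$ and $V$ of $F$ with $z+W(U,V)\subseteq O$. Put $W_{\alpha,\beta}=W(\{p_\alpha\le 1\},\{q_\beta\le 1\})$ and let $(p_\alpha\otimes q_\beta)(u)=\inf\{r>0:\ u\in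 rW_{\alpha,\beta}\}$ be its Minkowski functional. Then for all $\alpha\in I$, $\beta\in J$ the set $W_{\alpha,\beta}$ is absorbing, $p_\alpha\otimes q_\beta$ is a Riesz seminorm on $E\overline{\otimes}F$, and for every $u\in E\overline{\otimes}F$ $$(p_\alpha\otimes q_\beta)(u)=\inf\Big\{\sum_{i=1}^{n}p_\alpha(x_i)q_\beta(y_i):\ n\in\mathbb N,\ x_i\in E,\ y_i\in F,\ x_i\ge 0,\ y_i\ge 0,\ |u|\le\sum_{i=1}^{n}x_i\otimes y_i\Big\},$$ the infimum being taken over a nonempty set. Moreover, if both families are directed (any two members are dominated by a constant multiple of a third member), then the family $(p_\alpha\otimes q_\beta)_{(\alpha,\beta)\in I\times J}$ generates the topology $\tau_F$. -/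

import Mathlib

open scoped Topology Pointwise

universe u v w

/-- A (real) vector lattice is Archimedean if `n x ≤ y` for all `n : ℕ` forces `x ≤ 0`.
(Mathlib's `Archimedean` is the much stronger notion for totally ordered groups.) -/
class ArchimedeanLattice (E : Type u) [AddCommGroup E] [Lattice E] : Prop where
  le_zero_of_forall_nsmul_le : ∀ x y : E, (∀ n : ℕ, n • x ≤ y) → x ≤ 0

/-- A lattice bimorphism `E × F → G`: a bilinear map for which `Φ(·, y)` and `Φ(x, ·)` are
lattice homomorphisms for all `y ≥ 0` and all `x ≥ 0`. -/
structure IsLatticeBimorphism {E : Type u} {F : Type v} {G : Type w}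
    [AddCommGroup E] [Module ℝ E] [Lattice E]
    [AddCommGroup F] [Module ℝ F] [Lattice F]
    [AddCommGroup G] [Module ℝ G] [Lattice G] (Φ : E → F → G) : Prop where
  add_left : ∀ x x' y, Φ (x + x') y = Φ x y + Φ x' y
  add_right : ∀ x y y', Φ x (y + y') = Φ x y + Φ x y'
  smul_left : ∀ (c : ℝ) x y, Φ (c • x) y = c • Φ x y
  smul_right : ∀ (c : ℝ) x y, Φ x (c • y) = c • Φ x y
  sup_left : ∀ x x' y, 0 ≤ y → Φ (x ⊔ x') y = Φ x y ⊔ Φ x' y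
  sup_right : ∀ x y y', 0 ≤ x → Φ x (y ⊔ y') = Φ x y ⊔ Φ x y'

/-! ### The Fremlin tensor product

`E ⊗̄ F` is built as the Archimedean vector lattice generated by symbols `x ⊗ y` subject to the
relations that make `(x, y) ↦ x ⊗ y` a lattice bimorphism. -/

/-- Formal vector lattice expressions in the symbols `x ⊗ y`. -/
inductive PreFremlin (E : Type u) (F : Type v) : Type (max u v)
  | tmul (x : E) (y : F) : PreFremlin E F
  | zero : PreFremlin E F
  | add (a b : PreFremlin E F) : PreFremlin E F
  | smul (c : ℝ) (a : PreFremlin E F) : PreFremlin E F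
  | sup (a b : PreFremlin E F) : PreFremlin E F

namespace PreFremlin

variable {E : Type u} {F : Type v}
  [AddCommGroup E] [Module ℝ E] [Lattice E] [AddCommGroup F] [Module ℝ F] [Lattice F]

/-- The defining identities: the vector space axioms and those saying that `⊗` is a lattice
bimorphism. -/
inductive Ax : PreFremlin E F → PreFremlin E F → Prop
  | add_comm (a b) : Ax (add a b) (add b a)
  | add_assoc (a b c) : Ax (add (add a b) c) (add a (add b c))
  | zero_add (a) : Ax (add zero a) a
  | neg_add (a) : Ax (add (smul (-1) a) a) zero
  | smul_add (c a b) : Ax (smul c (add a b)) (add (smul c a) (smul c b))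
  | add_smul (c d a) : Ax (smul (c + d) a) (add (smul c a) (smul d a))
  | mul_smul (c d a) : Ax (smul (c * d) a) (smul c (smul d a))
  | one_smul (a) : Ax (smul 1 a) a
  | add_tmul (x x' y) : Ax (tmul (x + x') y) (add (tmul x y) (tmul x' y))
  | tmul_add (x y y') : Ax (tmul x (y + y')) (add (tmul x y) (tmul x y'))
  | smul_tmul (c : ℝ) (x y) : Ax (tmul (c • x) y) (smul c (tmul x y))
  | tmul_smul (c : ℝ) (x y) : Ax (tmul x (c • y)) (smul c (tmul x y))
  | sup_tmul (x x' y) : 0 ≤ y → Ax (tmul (x ⊔ x') y) (sup (tmul x y) (tmul x' y))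
  | tmul_sup (x y y') : 0 ≤ x → Ax (tmul x (y ⊔ y')) (sup (tmul x y) (tmul x y'))

/-- The smallest preorder on formal expressions that satisfies the defining identities, is
compatible with addition and scalar multiplication, has `sup` as supremum and is Archimedean. -/
inductive Le : PreFremlin E F → PreFremlin E F → Prop
  | refl (a) : Le a a
  | trans {a b c} : Le a b → Le b c → Le a c
  | ax {a b} : Ax a b → Le a b
  | ax_symm {a b} : Ax a b → Le b a
  | add {a b a' b'} : Le a b → Le a' b' → Le (add a a') (add b b')
  | smul_nonneg {c a b} : 0 ≤ c → Le a b → Le (smul c a) (smul c b)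
  | smul_nonpos {c a b} : c ≤ 0 → Le a b → Le (smul c b) (smul c a)
  | le_sup_left (a b) : Le a (sup a b)
  | le_sup_right (a b) : Le b (sup a b)
  | sup_le {a b c} : Le a c → Le b c → Le (sup a b) c
  | archimedean {a b} : (∀ n : ℕ, Le (smul n a) b) → Le a zero

instance instPreorder : Preorder (PreFremlin E F) where
  le := Le
  le_refl := Le.refl
  le_trans _ _ _ := Le.trans

end PreFremlin

/-- The Fremlin tensor product `E ⊗̄ F`: formal expressions, two of them being identified when
each is below the other. -/
def FremlinTensor (E : Type u) (F : Type v)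
    [AddCommGroup E] [Module ℝ E] [Lattice E] [AddCommGroup F] [Module ℝ F] [Lattice F] :
    Type (max u v) :=
  Antisymmetrization (PreFremlin E F) (· ≤ ·)

namespace FremlinTensor

variable {E : Type u} {F : Type v}
  [AddCommGroup E] [Module ℝ E] [Lattice E] [AddCommGroup F] [Module ℝ F] [Lattice F]

/-- The class of a formal expression. -/
def mk (a : PreFremlin E F) : FremlinTensor E F := toAntisymmetrization (· ≤ ·) a

instance instPartialOrder : PartialOrder (FremlinTensor E F) :=
  inferInstanceAs (PartialOrder (Antisymmetrization (PreFremlin E F) (· ≤ ·)))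

theorem mk_le_mk {a b : PreFremlin E F} : mk a ≤ mk b ↔ PreFremlin.Le a b := Iff.rfl

theorem mk_eq_of_ax {a b : PreFremlin E F} (h : PreFremlin.Ax a b) : mk a = mk b :=
  le_antisymm (mk_le_mk.2 (.ax h)) (mk_le_mk.2 (.ax_symm h))

theorem ind {P : FremlinTensor E F → Prop} (h : ∀ a, P (mk a)) (z : FremlinTensor E F) : P z :=
  Quotient.ind h z

/-- The elementary tensor `x ⊗ y`. -/
def tmul (x : E) (y : F) : FremlinTensor E F := mk (.tmul x y)

instance : Zero (FremlinTensor E F) := ⟨mk .zero⟩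

instance : Add (FremlinTensor E F) :=
  ⟨Quotient.map₂ PreFremlin.add fun _ _ h _ _ h' =>
    ⟨PreFremlin.Le.add h.1 h'.1, PreFremlin.Le.add h.2 h'.2⟩⟩

instance : SMul ℝ (FremlinTensor E F) :=
  ⟨fun c => Quotient.map (PreFremlin.smul c) fun _ _ h => by
    rcases le_total 0 c with hc | hc
    · exact ⟨PreFremlin.Le.smul_nonneg hc h.1, PreFremlin.Le.smul_nonneg hc h.2⟩
    · exact ⟨PreFremlin.Le.smul_nonpos hc h.2, PreFremlin.Le.smul_nonpos hc h.1⟩⟩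

theorem mk_add (a b : PreFremlin E F) : mk (a.add b) = mk a + mk b := rfl
theorem mk_smul (c : ℝ) (a : PreFremlin E F) : mk (a.smul c) = c • mk a := rfl
theorem mk_zero : mk (E := E) (F := F) .zero = 0 := rfl

instance : Neg (FremlinTensor E F) := ⟨fun z => (-1 : ℝ) • z⟩

instance instAddCommGroup : AddCommGroup (FremlinTensor E F) where
  add_assoc a b c := by
    induction a using ind; induction b using ind; induction c using ind
    exact mk_eq_of_ax (.add_assoc _ _ _)
  zero_add a := by
    induction a using ind
    exact mk_eq_of_ax (.zero_add _)
  add_zero a := by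
    induction a using ind
    exact (mk_eq_of_ax (.add_comm _ _)).trans (mk_eq_of_ax (.zero_add _))
  add_comm a b := by
    induction a using ind; induction b using ind
    exact mk_eq_of_ax (.add_comm _ _)
  neg_add_cancel a := by
    induction a using ind
    exact mk_eq_of_ax (.neg_add _)
  nsmul := nsmulRec
  zsmul := zsmulRec

theorem fremlin_smul_add (c : ℝ) (a b : FremlinTensor E F) : c • (a + b) = c • a + c • b := by
  induction a using ind; induction b using ind
  exact mk_eq_of_ax (.smul_add _ _ _)

theorem fremlin_add_smul (c d : ℝ) (a : FremlinTensor E F) : (c + d) • a = c • a + d • a := by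
  induction a using ind
  exact mk_eq_of_ax (.add_smul _ _ _)

instance instModule : Module ℝ (FremlinTensor E F) where
  one_smul a := by
    induction a using ind
    exact mk_eq_of_ax (.one_smul _)
  mul_smul c d a := by
    induction a using ind
    exact mk_eq_of_ax (.mul_smul _ _ _)
  smul_add := fremlin_smul_add
  smul_zero c := by
    have h := fremlin_smul_add c (0 : FremlinTensor E F) 0
    rw [add_zero] at h
    exact left_eq_add.1 h
  add_smul := fremlin_add_smul
  zero_smul a := by
    have h := fremlin_add_smul 0 0 a
    rw [add_zero] at h
    exact left_eq_add.1 h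

instance instIsOrderedAddMonoid : IsOrderedAddMonoid (FremlinTensor E F) where
  add_le_add_left a b h c := by
    induction a using ind; induction b using ind; induction c using ind
    exact PreFremlin.Le.add h (.refl _)

instance instIsOrderedModule : IsOrderedModule ℝ (FremlinTensor E F) :=
  have : PosSMulMono ℝ (FremlinTensor E F) := ⟨fun c hc a b h => by
    induction a using ind; induction b using ind
    exact PreFremlin.Le.smul_nonneg hc h⟩
  { smul_le_smul_of_nonneg_right := fun a ha c d h => by
      have := smul_nonneg (sub_nonneg.2 h) ha
      rwa [sub_smul, sub_nonneg] at this }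

instance instSemilatticeSup : SemilatticeSup (FremlinTensor E F) where
  sup := Quotient.map₂ PreFremlin.sup fun _ _ h _ _ h' =>
    ⟨PreFremlin.Le.sup_le (h.1.trans (.le_sup_left _ _)) (h'.1.trans (.le_sup_right _ _)),
     PreFremlin.Le.sup_le (h.2.trans (.le_sup_left _ _)) (h'.2.trans (.le_sup_right _ _))⟩
  le_sup_left a b := by
    induction a using ind; induction b using ind
    exact PreFremlin.Le.le_sup_left _ _
  le_sup_right a b := by
    induction a using ind; induction b using ind
    exact PreFremlin.Le.le_sup_right _ _
  sup_le a b c h h' := by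
    induction a using ind; induction b using ind; induction c using ind
    exact PreFremlin.Le.sup_le h h'

instance instLattice : Lattice (FremlinTensor E F) where
  inf a b := -(-a ⊔ -b)
  inf_le_left _ _ := neg_le.1 le_sup_left
  inf_le_right _ _ := neg_le.1 le_sup_right
  le_inf _ _ _ h h' := le_neg.1 (sup_le (neg_le_neg h) (neg_le_neg h'))

theorem mk_sup (a b : PreFremlin E F) : mk (a.sup b) = mk a ⊔ mk b := rfl

instance instArchimedeanLattice : ArchimedeanLattice (FremlinTensor E F) where
  le_zero_of_forall_nsmul_le a b h := by
    induction a using ind with | _ a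
    induction b using ind with | _ b
    refine mk_le_mk.2 (PreFremlin.Le.archimedean (b := b) fun n => ?_)
    rw [← mk_le_mk, mk_smul, Nat.cast_smul_eq_nsmul]
    exact h n

theorem isLatticeBimorphism_tmul : IsLatticeBimorphism (tmul (E := E) (F := F)) where
  add_left x x' y := mk_eq_of_ax (.add_tmul x x' y)
  add_right x y y' := mk_eq_of_ax (.tmul_add x y y')
  smul_left c x y := mk_eq_of_ax (.smul_tmul c x y)
  smul_right c x y := mk_eq_of_ax (.tmul_smul c x y)
  sup_left x x' y h := mk_eq_of_ax (.sup_tmul x x' y h)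
  sup_right x y y' h := mk_eq_of_ax (.tmul_sup x y y' h)

/-- Evaluation of formal expressions along a map `Φ : E × F → G`. -/
def eval {G : Type w} [AddCommGroup G] [Module ℝ G] [Lattice G] (Φ : E → F → G) :
    PreFremlin E F → G
  | .tmul x y => Φ x y
  | .zero => 0
  | .add a b => eval Φ a + eval Φ b
  | .smul c a => c • eval Φ a
  | .sup a b => eval Φ a ⊔ eval Φ b

/-- The universal property that characterizes the Fremlin tensor product: every lattice bimorphism
into an Archimedean vector lattice (of any universe) factors through `⊗` by a unique lattice
homomorphism. -/
theorem existsUnique_lift {G : Type w} [AddCommGroup G] [Module ℝ G] [Lattice G]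
    [IsOrderedAddMonoid G] [IsOrderedModule ℝ G] [ArchimedeanLattice G]
    {Φ : E → F → G} (hΦ : IsLatticeBimorphism Φ) :
    ∃! T : FremlinTensor E F →ₗ[ℝ] G,
      (∀ a b, T (a ⊔ b) = T a ⊔ T b) ∧ (∀ a b, T (a ⊓ b) = T a ⊓ T b) ∧
        ∀ x y, T (tmul x y) = Φ x y := by
  have hax : ∀ {a b : PreFremlin E F}, PreFremlin.Ax a b → eval Φ a = eval Φ b := by
    intro a b h
    cases h with
    | add_comm => exact add_comm _ _
    | add_assoc => exact add_assoc _ _ _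
    | zero_add => exact zero_add _
    | neg_add => simp [eval]
    | smul_add => exact smul_add _ _ _
    | add_smul => exact add_smul _ _ _
    | mul_smul => exact mul_smul _ _ _
    | one_smul => exact one_smul _ _
    | add_tmul => exact hΦ.add_left _ _ _
    | tmul_add => exact hΦ.add_right _ _ _
    | smul_tmul => exact hΦ.smul_left _ _ _
    | tmul_smul => exact hΦ.smul_right _ _ _
    | sup_tmul _ _ _ h => exact hΦ.sup_left _ _ _ h
    | tmul_sup _ _ _ h => exact hΦ.sup_right _ _ _ h
  have hle : ∀ {a b : PreFremlin E F}, PreFremlin.Le a b → eval Φ a ≤ eval Φ b := by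
    intro a b h
    induction h with
    | refl => exact le_rfl
    | trans _ _ h h' => exact h.trans h'
    | ax h => exact (hax h).le
    | ax_symm h => exact (hax h).ge
    | add _ _ h h' => exact add_le_add h h'
    | smul_nonneg hc _ h => exact smul_le_smul_of_nonneg_left h hc
    | smul_nonpos hc _ h =>
      have := smul_le_smul_of_nonneg_left h (neg_nonneg.2 hc)
      rw [neg_smul, neg_smul] at this
      exact neg_le_neg_iff.1 this
    | le_sup_left => exact le_sup_left
    | le_sup_right => exact le_sup_right
    | sup_le _ _ h h' => exact sup_le h h'
    | @archimedean a b _ h =>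
      refine ArchimedeanLattice.le_zero_of_forall_nsmul_le _ (eval Φ b) fun n => ?_
      rw [← Nat.cast_smul_eq_nsmul ℝ]
      exact h n
  let f : FremlinTensor E F → G :=
    Quotient.lift (eval Φ) fun a b h => le_antisymm (hle h.1) (hle h.2)
  let T : FremlinTensor E F →ₗ[ℝ] G :=
    { toFun := f
      map_add' := fun a b => by
        induction a using ind; induction b using ind
        rfl
      map_smul' := fun c a => by
        induction a using ind
        rfl }
  have hsup : ∀ a b, T (a ⊔ b) = T a ⊔ T b := fun a b => by
    induction a using ind; induction b using ind
    rfl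
  refine ⟨T, ⟨hsup, fun a b => ?_, fun _ _ => rfl⟩, ?_⟩
  · have h : a ⊓ b = -(-a ⊔ -b) := by rw [neg_sup, neg_neg, neg_neg]
    rw [h, map_neg, hsup, map_neg, map_neg, neg_sup, neg_neg, neg_neg]
  · rintro S ⟨hS, -, hS'⟩
    ext z
    induction z using ind with | _ a
    induction a with
    | tmul x y => exact hS' x y
    | zero => exact (map_zero S).trans (map_zero T).symm
    | add a b ha hb => rw [mk_add, map_add, map_add, ha, hb]
    | smul c a ha => rw [mk_smul, map_smul, map_smul, ha]
    | sup a b ha hb => rw [mk_sup, hS, hsup, ha, hb]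

end FremlinTensor

/-! ### Riesz seminorms, hulls and the topology `τ_F` -/

/-- A Riesz seminorm on a vector lattice: `|x| ≤ |y|` implies `p x ≤ p y`. -/
def Seminorm.IsRiesz {E : Type u} [AddCommGroup E] [Module ℝ E] [Lattice E]
    (p : Seminorm ℝ E) : Prop :=
  ∀ x y : E, |x| ≤ |y| → p x ≤ p y

/-- A family of seminorms is directed if any two of its members are dominated by a multiple of a
third one; equivalently (for a nonempty generating family), the multiples of the unit balls of its
members form a base of the zero neighborhoods. -/
def SeminormFamily.IsDirected {E : Type u} [AddCommGroup E] [Module ℝ E] {ι : Type v}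
    (p : ι → Seminorm ℝ E) : Prop :=
  ∀ i j, ∃ k, ∃ C : ℝ, ∀ x, p i x ≤ C * p k x ∧ p j x ≤ C * p k x

/-- The convex balanced hull of a set. -/
def convexBalancedHull {G : Type u} [AddCommGroup G] [Module ℝ G] (A : Set G) : Set G :=
  {z | ∃ (n : ℕ) (c : Fin n → ℝ) (a : Fin n → G),
    (∀ i, a i ∈ A) ∧ ∑ i, |c i| ≤ 1 ∧ z = ∑ i, c i • a i}

namespace FremlinTensor

variable {E : Type u} {F : Type v}
  [AddCommGroup E] [Module ℝ E] [Lattice E] [AddCommGroup F] [Module ℝ F] [Lattice F]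

/-- `Conv_b (Sol (U ⊗ V))`, where `U ⊗ V = {x ⊗ y : x ∈ U, y ∈ V}`. -/
def tensorHull (U : Set E) (V : Set F) : Set (FremlinTensor E F) :=
  convexBalancedHull (LatticeOrderedAddCommGroup.solidClosure (Set.image2 tmul U V))

theorem tensorHull_mono {U U' : Set E} {V V' : Set F} (hU : U ⊆ U') (hV : V ⊆ V') :
    tensorHull U V ⊆ tensorHull U' V' := by
  rintro z ⟨n, c, a, ha, hc, rfl⟩
  refine ⟨n, c, a, fun i => ?_, hc, rfl⟩
  obtain ⟨t, ht, hat⟩ := ha i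
  exact ⟨t, Set.image2_subset hU hV ht, hat⟩

/-- Convex solid neighborhoods of zero. -/
def IsConvexSolidNhd {E : Type u} [AddCommGroup E] [Module ℝ E] [Lattice E] [TopologicalSpace E]
    (U : Set E) : Prop :=
  U ∈ 𝓝 (0 : E) ∧ Convex ℝ U ∧ LatticeOrderedAddCommGroup.IsSolid U

theorem IsConvexSolidNhd.inter {E : Type u} [AddCommGroup E] [Module ℝ E] [Lattice E]
    [TopologicalSpace E] {U V : Set E} (hU : IsConvexSolidNhd U) (hV : IsConvexSolidNhd V) :
    IsConvexSolidNhd (U ∩ V) :=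
  ⟨Filter.inter_mem hU.1 hV.1, hU.2.1.inter hV.2.1,
    fun _ hx _ hy => ⟨hU.2.2 hx.1 hy, hV.2.2 hx.2 hy⟩⟩

/-- The topology `τ_F` on `E ⊗̄ F`, for which the sets `Conv_b (Sol (U ⊗ V))`, with `U` and `V`
convex solid zero neighborhoods of `E` and `F`, are a base at zero: a set is open if around each of
its points it contains a translate of such a set. -/
@[reducible]
def fremlinTopology (E : Type u) (F : Type v)
    [AddCommGroup E] [Module ℝ E] [Lattice E] [TopologicalSpace E]
    [AddCommGroup F] [Module ℝ F] [Lattice F] [TopologicalSpace F] :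
    TopologicalSpace (FremlinTensor E F) where
  IsOpen s := ∀ z ∈ s, ∃ (U : Set E) (V : Set F), IsConvexSolidNhd U ∧ IsConvexSolidNhd V ∧
    ∀ h ∈ tensorHull U V, z + h ∈ s
  isOpen_univ _ _ := ⟨Set.univ, Set.univ,
    ⟨Filter.univ_mem, convex_univ, fun _ _ _ _ => trivial⟩,
    ⟨Filter.univ_mem, convex_univ, fun _ _ _ _ => trivial⟩, fun _ _ => trivial⟩
  isOpen_inter s t hs ht z hz := by
    obtain ⟨U, V, hU, hV, h⟩ := hs z hz.1
    obtain ⟨U', V', hU', hV', h'⟩ := ht z hz.2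
    exact ⟨U ∩ U', V ∩ V', hU.inter hU', hV.inter hV', fun w hw =>
      ⟨h w (tensorHull_mono Set.inter_subset_left Set.inter_subset_left hw),
        h' w (tensorHull_mono Set.inter_subset_right Set.inter_subset_right hw)⟩⟩
  isOpen_sUnion S hS z := by
    rintro ⟨s, hs, hz⟩
    obtain ⟨U, V, hU, hV, h⟩ := hS s hs z hz
    exact ⟨U, V, hU, hV, fun w hw => ⟨s, hs, h w hw⟩⟩

/-- `W = Conv_b (Sol (U ⊗ V))` for the unit balls `U = {p ≤ 1}` and `V = {q ≤ 1}`. -/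
def unitHull (p : Seminorm ℝ E) (q : Seminorm ℝ F) : Set (FremlinTensor E F) :=
  tensorHull {x | p x ≤ 1} {y | q y ≤ 1}

/-- The function `p ⊗ q` on `E ⊗̄ F`: the Minkowski functional
`u ↦ inf {r > 0 : u ∈ r W}` of `W = unitHull p q`. -/
noncomputable def tensorGauge (p : Seminorm ℝ E) (q : Seminorm ℝ F) (z : FremlinTensor E F) : ℝ :=
  gauge (unitHull p q) z

/-- The sums `∑ p(x_i) q(y_i)` over all finite families `x_i ≥ 0`, `y_i ≥ 0` with
`|z| ≤ ∑ x_i ⊗ y_i`. -/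
def projectiveSums (p : Seminorm ℝ E) (q : Seminorm ℝ F) (z : FremlinTensor E F) : Set ℝ :=
  {r | ∃ (n : ℕ) (x : Fin n → E) (y : Fin n → F), (∀ i, 0 ≤ x i) ∧ (∀ i, 0 ≤ y i) ∧
    |z| ≤ ∑ i, tmul (x i) (y i) ∧ r = ∑ i, p (x i) * q (y i)}

end FremlinTensor

/-! Everything rests on comparing the scaled hulls `r • unitHull p q` with the projective sums. If
`u` lies in `r • unitHull p q`, with `p` and `q` Riesz, the triangle inequality and `abs_tmul_le`
bound `|u|` by a sum of positive elementary tensors of cost at most `r`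
(`exists_mem_projectiveSums_le`). Conversely, if `|u|` is bounded by such a sum of cost below `r`,
Riesz decomposition splits `u` into pieces, each dominated by one summand, and normalizing the
pieces exhibits `u` in `r • unitHull p q` (`mem_smul_unitHull`). So the gauge is the infimum of the
projective sums. As these depend only on `|u|` and grow with fewer choices, the Riesz property
follows. Absorption reduces to the existence of one projective sum, obtained by induction on formal
expressions.

For the topology, the formula gives `tensorSeminorm_le_mul`: estimates on the factors multiply. Zero
neighborhoods of the factors may be replaced by unit balls of scaled finite suprema, so two
comparisons between tensor products of suprema and suprema of tensor products suffice. Directedness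
enters only where a tensor product of suprema must be bounded by the given family. -/

open scoped NNReal

/-! ### Riesz decomposition and absolute values -/

section VectorLattice

variable {G : Type u} [AddCommGroup G] [Lattice G] [IsOrderedAddMonoid G]

theorem sup_le_abs_add_abs (a b : G) : a ⊔ b ≤ |a| + |b| :=
  sup_le ((le_abs_self a).trans (le_add_of_nonneg_right (abs_nonneg b)))
    ((le_abs_self b).trans (le_add_of_nonneg_left (abs_nonneg a)))

theorem abs_sup_le_abs_add_abs (a b : G) : |a ⊔ b| ≤ |a| + |b| := by
  refine abs_le'.2 ⟨sup_le_abs_add_abs a b, ?_⟩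
  calc -(a ⊔ b) ≤ -a := neg_le_neg le_sup_left
    _ ≤ |a| := neg_le_abs a
    _ ≤ |a| + |b| := le_add_of_nonneg_right (abs_nonneg b)

/-- The Riesz decomposition property. -/
theorem exists_add_eq_of_abs_le_add {u a b : G} (ha : 0 ≤ a) (hb : 0 ≤ b) (h : |u| ≤ a + b) :
    ∃ v w : G, u = v + w ∧ |v| ≤ a ∧ |w| ≤ b := by
  obtain ⟨h₁, h₂⟩ := abs_le'.1 h
  -- The first piece is the truncation of `u` to the interval `[-a, a]`.
  refine ⟨(u ⊓ a) ⊔ (-a), u - ((u ⊓ a) ⊔ (-a)), (add_sub_cancel _ _).symm, ?_, ?_⟩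
  · exact abs_le'.2 ⟨sup_le inf_le_right ((neg_nonpos.2 ha).trans ha), neg_le.1 le_sup_right⟩
  · refine abs_le'.2 ⟨?_, ?_⟩
    · rw [sub_le_comm]
      exact (le_inf (sub_le_self _ hb) (sub_le_iff_le_add.2 h₁)).trans le_sup_left
    · rw [neg_sub, sub_le_iff_le_add]
      refine sup_le (inf_le_left.trans (le_add_of_nonneg_left hb)) ?_
      rw [neg_le_iff_add_nonneg]
      have := neg_le_iff_add_nonneg.1 h₂
      convert this using 1
      abel

theorem exists_sum_eq_of_abs_le_sum {n : ℕ} {u : G} {a : Fin n → G} (ha : ∀ i, 0 ≤ a i)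
    (h : |u| ≤ ∑ i, a i) : ∃ v : Fin n → G, u = ∑ i, v i ∧ ∀ i, |v i| ≤ a i := by
  induction n generalizing u with
  | zero =>
    refine ⟨fun _ => 0, ?_, fun i => i.elim0⟩
    have h₀ : |u| ≤ 0 := by simpa using h
    obtain ⟨h₁, h₂⟩ := abs_le'.1 h₀
    simpa using le_antisymm h₁ (neg_nonpos.1 h₂)
  | succ n ih =>
    rw [Fin.sum_univ_succ] at h
    obtain ⟨v, w, rfl, hv, hw⟩ :=
      exists_add_eq_of_abs_le_add (ha 0) (Finset.sum_nonneg fun i _ => ha i.succ) h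
    obtain ⟨t, rfl, ht⟩ := ih (fun i => ha i.succ) hw
    exact ⟨Fin.cons v t, by simp [Fin.sum_univ_succ], Fin.cases hv ht⟩

theorem abs_sum_le_sum_abs_of_lattice {ι : Type v} (s : Finset ι) (f : ι → G) :
    |∑ i ∈ s, f i| ≤ ∑ i ∈ s, |f i| :=
  Finset.le_sum_of_subadditive _ abs_zero.le abs_add_le _ _

end VectorLattice

theorem abs_smul_le_smul_abs {G : Type u} [AddCommGroup G] [Lattice G] [Module ℝ G]
    [IsOrderedModule ℝ G] (c : ℝ) (a : G) : |c • a| ≤ |c| • |a| := by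
  have key : ∀ b : G, b ≤ |a| → -b ≤ |a| → c • b ≤ |c| • |a| := fun b hb hb' => by
    rcases le_total 0 c with hc | hc
    · rw [abs_of_nonneg hc]
      exact smul_le_smul_of_nonneg_left hb hc
    · rw [abs_of_nonpos hc, ← neg_smul_neg]
      exact smul_le_smul_of_nonneg_left hb' (neg_nonneg.2 hc)
  refine abs_le'.2 ⟨key a (le_abs_self a) (neg_le_abs a), ?_⟩
  rw [← smul_neg]
  exact key (-a) (neg_le_abs a) (by simpa using le_abs_self a)

/-! ### Convex balanced hulls -/

section ConvexBalancedHull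

variable {G : Type u} [AddCommGroup G] [Module ℝ G]

theorem balanced_convexBalancedHull (A : Set G) : Balanced ℝ (convexBalancedHull A) := by
  rintro c hc _ ⟨_, ⟨n, d, a, ha, hd, rfl⟩, rfl⟩
  refine ⟨n, fun i => c * d i, a, ha, ?_, by simp [Finset.smul_sum, mul_smul]⟩
  simp_rw [abs_mul, ← Finset.mul_sum]
  exact mul_le_one₀ hc (Finset.sum_nonneg fun i _ => abs_nonneg _) hd

theorem convex_convexBalancedHull (A : Set G) : Convex ℝ (convexBalancedHull A) := by
  rintro _ ⟨n, c, a, ha, hc, rfl⟩ _ ⟨m, d, b, hb, hd, rfl⟩ s t hs ht hst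
  refine ⟨n + m, Fin.append (fun i => s * c i) (fun i => t * d i), Fin.append a b, ?_, ?_, ?_⟩
  · exact Fin.addCases (by simpa using ha) (by simpa using hb)
  · simp only [Fin.sum_univ_add, Fin.append_left, Fin.append_right, abs_mul, ← Finset.mul_sum,
      abs_of_nonneg hs, abs_of_nonneg ht]
    calc s * ∑ i, |c i| + t * ∑ i, |d i| ≤ s * 1 + t * 1 := by gcongr
      _ = 1 := by rw [mul_one, mul_one, hst]
  · simp [Fin.sum_univ_add, Finset.smul_sum, mul_smul]

end ConvexBalancedHull

/-! ### Riesz seminorms and directed families -/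

namespace Seminorm

variable {E : Type u} [AddCommGroup E] [Module ℝ E] [Lattice E]

theorem IsRiesz.finset_sup {ι : Type v} {p : ι → Seminorm ℝ E} (hp : ∀ i, (p i).IsRiesz)
    (s : Finset ι) : (s.sup p).IsRiesz := by
  intro x y h
  classical
  induction s using Finset.induction with
  | empty => simp
  | insert i s _ ih =>
    rw [Finset.sup_insert, sup_apply, sup_apply]
    exact sup_le_sup (hp i x y h) ih

theorem IsRiesz.nnreal_smul {p : Seminorm ℝ E} (hp : p.IsRiesz) (c : ℝ≥0) : (c • p).IsRiesz :=
  fun x y h => by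
    rw [smul_apply, smul_apply]
    exact smul_le_smul_of_nonneg_left (hp x y h) c.2

theorem IsRiesz.apply_abs [IsOrderedAddMonoid E] {p : Seminorm ℝ E} (hp : p.IsRiesz) (x : E) :
    p |x| = p x :=
  le_antisymm (hp _ _ (abs_abs x).le) (hp _ _ (abs_abs x).ge)

end Seminorm

/-- Induction on the finite set. The zero alternative covers the empty supremum, for which the index
type may offer no `k` at all. -/
theorem SeminormFamily.IsDirected.finset_sup_le {E : Type u} [AddCommGroup E] [Module ℝ E]
    {ι : Type v} {p : ι → Seminorm ℝ E} (hp : SeminormFamily.IsDirected p) (s : Finset ι) :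
    s.sup p = 0 ∨ ∃ k, ∃ C : ℝ, 0 ≤ C ∧ ∀ x, s.sup p x ≤ C * p k x := by
  classical
  induction s using Finset.induction with
  | empty => exact Or.inl rfl
  | insert i s _ ih =>
    right
    rw [Finset.sup_insert]
    rcases ih with h | ⟨j, D, hD, h⟩
    · refine ⟨i, 1, zero_le_one, fun x => ?_⟩
      simp [h]
    · obtain ⟨k, C, hC⟩ := hp i j
      -- The summand 1 serves the new member and `D` the earlier ones; `|C|` is needed because
      -- directedness does not give a nonnegative constant.
      refine ⟨k, (1 + D) * |C|, by positivity, fun x => ?_⟩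
      have h₀ : 0 ≤ |C| * p k x := by positivity
      have h₁ : C * p k x ≤ |C| * p k x :=
        mul_le_mul_of_nonneg_right (le_abs_self C) (apply_nonneg _ _)
      rw [Seminorm.sup_apply, mul_assoc]
      refine sup_le ?_ ?_
      · nlinarith [(hC x).1, mul_nonneg hD h₀]
      · nlinarith [h x, mul_le_mul_of_nonneg_left ((hC x).2.trans h₁) hD]

/-! ### Elementary tensors and the gauge of the hull -/

namespace FremlinTensor

variable {E : Type u} {F : Type v}
  [AddCommGroup E] [Module ℝ E] [Lattice E] [AddCommGroup F] [Module ℝ F] [Lattice F]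

theorem tmul_neg_left (x : E) (y : F) : tmul (-x) y = -tmul x y := by
  rw [← neg_one_smul ℝ x, isLatticeBimorphism_tmul.smul_left, neg_one_smul]

theorem tmul_neg_right (x : E) (y : F) : tmul x (-y) = -tmul x y := by
  rw [← neg_one_smul ℝ y, isLatticeBimorphism_tmul.smul_right, neg_one_smul]

theorem abs_tmul_of_nonneg_right (x : E) {y : F} (hy : 0 ≤ y) : |tmul x y| = tmul |x| y := by
  rw [abs, abs, isLatticeBimorphism_tmul.sup_left _ _ _ hy, tmul_neg_left]

theorem tmul_nonneg [IsOrderedAddMonoid E] {x : E} {y : F} (hx : 0 ≤ x) (hy : 0 ≤ y) :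
    0 ≤ tmul x y := by
  rw [← abs_of_nonneg hx, ← abs_tmul_of_nonneg_right x hy]
  exact abs_nonneg _

/-- Scalars move freely across `⊗`, so a bound on the product `p x * q y` can be distributed over
the factors until each lies in its unit ball. -/
theorem exists_smul_tmul_eq {p : Seminorm ℝ E} {q : Seminorm ℝ F} {x : E} {y : F} {c : ℝ}
    (h : p x * q y < c) :
    ∃ x' y', p x' ≤ 1 ∧ q y' ≤ 1 ∧ c⁻¹ • tmul x y = tmul x' y' := by
  have hp : 0 ≤ p x := apply_nonneg _ _
  have hq : 0 ≤ q y := apply_nonneg _ _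
  have hc : 0 < c := (mul_nonneg hp hq).trans_lt h
  -- `a` is the scale removed from `x`, leaving `c / a` for `y`. When `q y = 0`, any positive `a`
  -- above `p x` works.
  obtain ⟨a, ha, hxa, hya⟩ : ∃ a : ℝ, 0 < a ∧ p x ≤ a ∧ a * q y ≤ c := by
    rcases hq.eq_or_lt with h₀ | h₀
    · exact ⟨p x + 1, by positivity, by simp, by simp [← h₀, hc.le]⟩
    · exact ⟨c / q y, by positivity, ((lt_div_iff₀ h₀).2 h).le, (div_mul_cancel₀ _ h₀.ne').le⟩
  refine ⟨a⁻¹ • x, (c⁻¹ * a) • y, ?_, ?_, ?_⟩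
  · rw [map_smul_eq_mul, Real.norm_of_nonneg (inv_nonneg.2 ha.le)]
    exact inv_mul_le_one_of_le₀ hxa ha.le
  · rw [map_smul_eq_mul, Real.norm_of_nonneg (by positivity), mul_assoc]
    exact inv_mul_le_one_of_le₀ hya hc.le
  · rw [isLatticeBimorphism_tmul.smul_left, isLatticeBimorphism_tmul.smul_right, smul_smul]
    congr 1
    field_simp

theorem balanced_unitHull (p : Seminorm ℝ E) (q : Seminorm ℝ F) : Balanced ℝ (unitHull p q) :=
  balanced_convexBalancedHull _

theorem mem_smul_unitHull [IsOrderedAddMonoid E] {p : Seminorm ℝ E} {q : Seminorm ℝ F}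
    {u : FremlinTensor E F} {s r : ℝ} (hs : s ∈ projectiveSums p q u) (hsr : s < r) : u ∈ r • unitHull p q := by
  obtain ⟨n, x, y, hx, hy, hu, rfl⟩ := hs
  obtain ⟨v, rfl, hv⟩ := exists_sum_eq_of_abs_le_sum (fun i => tmul_nonneg (hx i) (hy i)) hu
  set s := ∑ i, p (x i) * q (y i)
  have hr : 0 < r := (Finset.sum_nonneg fun i _ => by positivity).trans_lt hsr
  -- The slack `r - s` is shared out so that every weight `c i` is positive, even if its cost
  -- vanishes, while the total stays at most `r`; `n + 1` also admits `n = 0`.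
  set ε := (r - s) / (n + 1)
  have hε : 0 < ε := div_pos (sub_pos.2 hsr) (by positivity)
  let c : Fin n → ℝ := fun i => p (x i) * q (y i) + ε
  have hc : ∀ i, 0 < c i := fun i => by positivity
  have hsum : ∑ i, c i ≤ r := by
    have h : (n + 1) * ε = r - s := mul_div_cancel₀ _ (by positivity)
    rw [Finset.sum_add_distrib, Finset.sum_const, Finset.card_univ, Fintype.card_fin, nsmul_eq_mul]
    change s + n * ε ≤ r
    linarith
  refine (Set.mem_smul_set_iff_inv_smul_mem₀ hr.ne' _ _).2
    ⟨n, fun i => r⁻¹ * c i, fun i => (c i)⁻¹ • v i, fun i => ?_, ?_, ?_⟩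
  · obtain ⟨x', y', hx', hy', h⟩ :=
      exists_smul_tmul_eq (p := p) (q := q) (lt_add_of_pos_right (p (x i) * q (y i)) hε)
    refine ⟨tmul x' y', Set.mem_image2_of_mem hx' hy', ?_⟩
    calc |(c i)⁻¹ • v i| ≤ |(c i)⁻¹| • |v i| := abs_smul_le_smul_abs _ _
      _ = (c i)⁻¹ • |v i| := by rw [abs_of_pos (inv_pos.2 (hc i))]
      _ ≤ (c i)⁻¹ • tmul (x i) (y i) :=
        smul_le_smul_of_nonneg_left (hv i) (inv_nonneg.2 (hc i).le)
      _ = tmul x' y' := h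
      _ ≤ |tmul x' y'| := le_abs_self _
  · calc ∑ i, |r⁻¹ * c i| = r⁻¹ * ∑ i, c i := by
          rw [Finset.mul_sum]
          exact Finset.sum_congr rfl fun i _ => abs_of_pos (mul_pos (inv_pos.2 hr) (hc i))
      _ ≤ 1 := inv_mul_le_one_of_le₀ hsum hr.le
  · rw [Finset.smul_sum]
    exact Finset.sum_congr rfl fun i _ => by rw [mul_smul, smul_inv_smul₀ (hc i).ne']

variable [IsOrderedAddMonoid F]

/-- Splitting `y` into positive and negative parts reduces this to positive second factors, where
`⊗` is a lattice homomorphism in `x`. -/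
theorem abs_tmul_le (x : E) (y : F) : |tmul x y| ≤ tmul |x| |y| := by
  have h : tmul x y = tmul x y⁺ + -tmul x y⁻ := by
    rw [← tmul_neg_right, ← isLatticeBimorphism_tmul.add_right, ← sub_eq_add_neg,
      posPart_sub_negPart]
  calc |tmul x y| ≤ |tmul x y⁺| + |-tmul x y⁻| := by rw [h]; exact abs_add_le _ _
    _ = tmul |x| |y| := by
      rw [abs_neg, abs_tmul_of_nonneg_right x (posPart_nonneg y),
        abs_tmul_of_nonneg_right x (negPart_nonneg y), ← isLatticeBimorphism_tmul.add_right,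
        posPart_add_negPart]

variable [IsOrderedAddMonoid E] [IsOrderedModule ℝ E]

/-- Every element of `E ⊗̄ F` is dominated by a finite sum of positive elementary tensors. -/
theorem exists_abs_le_sum_tmul (u : FremlinTensor E F) :
    ∃ (n : ℕ) (x : Fin n → E) (y : Fin n → F), (∀ i, 0 ≤ x i) ∧ (∀ i, 0 ≤ y i) ∧
      |u| ≤ ∑ i, tmul (x i) (y i) := by
  -- Domination passes to anything bounded by `|a| + |b|`, by concatenating families; this serves
  -- both sums and suprema.
  have dom_add : ∀ {a b c : FremlinTensor E F}, |c| ≤ |a| + |b| →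
      (∃ (n : ℕ) (x : Fin n → E) (y : Fin n → F), (∀ i, 0 ≤ x i) ∧ (∀ i, 0 ≤ y i) ∧
        |a| ≤ ∑ i, tmul (x i) (y i)) →
      (∃ (n : ℕ) (x : Fin n → E) (y : Fin n → F), (∀ i, 0 ≤ x i) ∧ (∀ i, 0 ≤ y i) ∧
        |b| ≤ ∑ i, tmul (x i) (y i)) →
      ∃ (n : ℕ) (x : Fin n → E) (y : Fin n → F), (∀ i, 0 ≤ x i) ∧ (∀ i, 0 ≤ y i) ∧
        |c| ≤ ∑ i, tmul (x i) (y i) := by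
    rintro a b c h ⟨n, x, y, hx, hy, ha⟩ ⟨m, x', y', hx', hy', hb⟩
    refine ⟨n + m, Fin.append x x', Fin.append y y',
      Fin.addCases (by simpa using hx) (by simpa using hx'),
      Fin.addCases (by simpa using hy) (by simpa using hy'), ?_⟩
    simpa [Fin.sum_univ_add] using h.trans (add_le_add ha hb)
  induction u using ind with | _ a
  induction a with
  | tmul x y =>
    exact ⟨1, fun _ => |x|, fun _ => |y|, fun _ => abs_nonneg x, fun _ => abs_nonneg y,
      by rw [Fin.sum_univ_one]; exact abs_tmul_le x y⟩
  | zero => exact ⟨0, fun _ => 0, fun _ => 0, fun i => i.elim0, fun i => i.elim0, by simp [mk_zero]⟩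
  | add a b ha hb => exact dom_add (by rw [mk_add]; exact abs_add_le _ _) ha hb
  | sup a b ha hb => exact dom_add (by rw [mk_sup]; exact abs_sup_le_abs_add_abs _ _) ha hb
  | smul c a ha =>
    obtain ⟨n, x, y, hx, hy, h⟩ := ha
    refine ⟨n, fun i => |c| • x i, y, fun i => smul_nonneg (abs_nonneg c) (hx i), hy, ?_⟩
    simp_rw [isLatticeBimorphism_tmul.smul_left, ← Finset.smul_sum]
    rw [mk_smul]
    exact (abs_smul_le_smul_abs c _).trans (smul_le_smul_of_nonneg_left h (abs_nonneg c))

theorem projectiveSums_nonempty (p : Seminorm ℝ E) (q : Seminorm ℝ F) (u : FremlinTensor E F) :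
    (projectiveSums p q u).Nonempty := by
  obtain ⟨n, x, y, hx, hy, h⟩ := exists_abs_le_sum_tmul u
  exact ⟨_, n, x, y, hx, hy, h, rfl⟩


theorem exists_mem_projectiveSums_le {p : Seminorm ℝ E} {q : Seminorm ℝ F} (hp : p.IsRiesz)
    (hq : q.IsRiesz) {u : FremlinTensor E F} {r : ℝ} (hr : 0 ≤ r) (hu : u ∈ r • unitHull p q) :
    ∃ s ∈ projectiveSums p q u, s ≤ r := by
  obtain ⟨_, ⟨n, c, a, ha, hc, rfl⟩, rfl⟩ := hu
  choose t ht hat using ha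
  choose x hx y hy hxy using ht
  -- The coefficient is absorbed into the first factor; since `x i` and `y i` lie in the unit balls,
  -- each term costs at most `r * |c i|`.
  refine ⟨_, ⟨n, fun i => (r * |c i|) • |x i|, fun i => |y i|,
    fun i => smul_nonneg (by positivity) (abs_nonneg _), fun i => abs_nonneg _, ?_, rfl⟩, ?_⟩
  · change |r • ∑ i, c i • a i| ≤ _
    rw [Finset.smul_sum]
    refine (abs_sum_le_sum_abs_of_lattice _ _).trans (Finset.sum_le_sum fun i _ => ?_)
    rw [smul_smul, isLatticeBimorphism_tmul.smul_left]
    calc |(r * c i) • a i| ≤ |r * c i| • |a i| := abs_smul_le_smul_abs _ _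
      _ = (r * |c i|) • |a i| := by rw [abs_mul, abs_of_nonneg hr]
      _ ≤ (r * |c i|) • tmul |x i| |y i| := by
        refine smul_le_smul_of_nonneg_left ((hat i).trans ?_) (by positivity)
        rw [← hxy i]
        exact abs_tmul_le _ _
  · calc ∑ i, p ((r * |c i|) • |x i|) * q |y i| ≤ ∑ i, r * |c i| := by
          refine Finset.sum_le_sum fun i _ => ?_
          have h₀ : 0 ≤ r * |c i| := by positivity
          rw [map_smul_eq_mul, Real.norm_of_nonneg h₀, hp.apply_abs, hq.apply_abs, mul_assoc]
          exact mul_le_of_le_one_right h₀ (mul_le_one₀ (hx i) (apply_nonneg _ _) (hy i))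
      _ = r * ∑ i, |c i| := by rw [Finset.mul_sum]
      _ ≤ r := mul_le_of_le_one_right hr hc

theorem absorbent_unitHull (p : Seminorm ℝ E) (q : Seminorm ℝ F) :
    Absorbent ℝ (unitHull p q) := by
  intro u
  obtain ⟨s, hs⟩ := projectiveSums_nonempty p q u
  refine absorbs_iff_norm.2 ⟨s + 1, fun c hc => Set.singleton_subset_iff.2 ?_⟩
  -- Balancedness lets the scalar be replaced by its norm, a nonnegative real.
  rw [(balanced_unitHull p q).smul_congr (norm_norm c).symm]
  exact mem_smul_unitHull hs (by linarith)

/-- The seminorm `p ⊗ q` on `E ⊗̄ F`. -/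
noncomputable def tensorSeminorm (p : Seminorm ℝ E) (q : Seminorm ℝ F) :
    Seminorm ℝ (FremlinTensor E F) :=
  gaugeSeminorm (balanced_unitHull p q) (convex_convexBalancedHull _) (absorbent_unitHull p q)

theorem isGLB_projectiveSums {p : Seminorm ℝ E} {q : Seminorm ℝ F} (hp : p.IsRiesz)
    (hq : q.IsRiesz) (u : FremlinTensor E F) :
    IsGLB (projectiveSums p q u) (tensorSeminorm p q u) := by
  refine ⟨fun s hs => le_of_forall_gt_imp_ge_of_dense fun r hr => ?_, fun m hm =>
    le_of_forall_gt_imp_ge_of_dense fun r hr => ?_⟩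
  · have hs₀ : 0 ≤ s := by
      obtain ⟨n, x, y, -, -, -, rfl⟩ := hs
      exact Finset.sum_nonneg fun i _ => by positivity
    exact gauge_le_of_mem (hs₀.trans hr.le) (mem_smul_unitHull hs hr)
  · obtain ⟨b, hb, hbr, hu⟩ := exists_lt_of_gauge_lt (absorbent_unitHull p q) hr
    obtain ⟨s, hs, hsb⟩ := exists_mem_projectiveSums_le hp hq hb.le hu
    exact (hm hs).trans (hsb.trans hbr.le)

theorem isRiesz_tensorSeminorm {p : Seminorm ℝ E} {q : Seminorm ℝ F} (hp : p.IsRiesz)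
    (hq : q.IsRiesz) : (tensorSeminorm p q).IsRiesz := by
  intro u v h
  refine (isGLB_projectiveSums hp hq v).mono (isGLB_projectiveSums hp hq u) ?_
  rintro _ ⟨n, x, y, hx, hy, hv, rfl⟩
  exact ⟨n, x, y, hx, hy, h.trans hv, rfl⟩

/-- Both sides are infima over the same dominating families, so the termwise estimate suffices. -/
theorem tensorSeminorm_le_mul {p p' : Seminorm ℝ E} {q q' : Seminorm ℝ F} (hp : p.IsRiesz)
    (hq : q.IsRiesz) (hp' : p'.IsRiesz) (hq' : q'.IsRiesz) {C D : ℝ} (hC : 0 ≤ C) (hD : 0 ≤ D)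
    (hpp' : ∀ x, p x ≤ C * p' x) (hqq' : ∀ y, q y ≤ D * q' y) (u : FremlinTensor E F) :
    tensorSeminorm p q u ≤ C * D * tensorSeminorm p' q' u := by
  have key : ∀ s ∈ projectiveSums p' q' u, tensorSeminorm p q u ≤ C * D * s := by
    rintro _ ⟨n, x, y, hx, hy, hu, rfl⟩
    refine ((isGLB_projectiveSums hp hq u).1 ⟨n, x, y, hx, hy, hu, rfl⟩).trans ?_
    rw [Finset.mul_sum]
    refine Finset.sum_le_sum fun i _ => ?_
    calc p (x i) * q (y i) ≤ (C * p' (x i)) * (D * q' (y i)) :=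
          mul_le_mul (hpp' _) (hqq' _) (apply_nonneg _ _) (by positivity)
      _ = C * D * (p' (x i) * q' (y i)) := by ring
  -- If `C * D = 0` one cannot divide, but a single projective sum already forces the left side to
  -- be at most 0.
  rcases (mul_nonneg hC hD).eq_or_lt with h | h
  · obtain ⟨s, hs⟩ := projectiveSums_nonempty p' q' u
    simpa [← h] using key s hs
  · rw [← div_le_iff₀' h]
    exact (isGLB_projectiveSums hp' hq' u).2 fun s hs => (div_le_iff₀' h).2 (key s hs)

theorem mem_unitHull_of_tensorSeminorm_lt_one {p : Seminorm ℝ E} {q : Seminorm ℝ F}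
    {u : FremlinTensor E F} (hu : tensorSeminorm p q u < 1) : u ∈ unitHull p q := by
  obtain ⟨b, hb, hb₁, h⟩ := exists_lt_of_gauge_lt (absorbent_unitHull p q) hu
  have := (balanced_unitHull p q).smul_mono (a := b) (b := (1 : ℝ))
    (by rw [Real.norm_of_nonneg hb.le, norm_one]; exact hb₁.le) h
  rwa [one_smul] at this

theorem tensorSeminorm_le_one_of_mem_unitHull {p : Seminorm ℝ E} {q : Seminorm ℝ F}
    {u : FremlinTensor E F} (hu : u ∈ unitHull p q) : tensorSeminorm p q u ≤ 1 :=
  gauge_le_one_of_mem hu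

end FremlinTensor

/-! ### Unit balls of finite suprema as zero neighborhoods -/

section ZeroNeighborhoods

variable {E : Type u} {ι : Type v} [AddCommGroup E] [Module ℝ E] [TopologicalSpace E]
  {p : ι → Seminorm ℝ E}

theorem WithSeminorms.exists_smul_finset_sup_le_one_subset (hp : WithSeminorms p) {U : Set E}
    (hU : U ∈ 𝓝 (0 : E)) :
    ∃ (s : Finset ι) (c : ℝ≥0), {x | (c • s.sup p) x ≤ 1} ⊆ U := by
  obtain ⟨s, r, hr, h⟩ := (hp.mem_nhds_iff 0 U).1 hU
  -- The closed condition then reads `s.sup p x ≤ r / 2`, which lies inside the open ball of radius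
  -- `r`.
  refine ⟨s, ⟨2 / r, by positivity⟩, fun x hx => h ?_⟩
  rw [Seminorm.mem_ball_zero]
  have hx' : 2 / r * s.sup p x ≤ 1 := hx
  rw [div_mul_eq_mul_div, div_le_one hr] at hx'
  linarith [apply_nonneg (s.sup p) x]

theorem FremlinTensor.isConvexSolidNhd_smul_finset_sup_le_one [Lattice E]
    (hp : WithSeminorms p) (hR : ∀ i, (p i).IsRiesz) (s : Finset ι) (c : ℝ≥0) :
    FremlinTensor.IsConvexSolidNhd {x | (c • s.sup p) x ≤ 1} := by
  -- Using `c + 1` instead of `c` keeps the radius defined when `c = 0`.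
  refine ⟨(hp.mem_nhds_iff 0 _).2 ⟨s, 1 / (c + 1), by positivity, fun x hx => ?_⟩, ?_,
    fun x hx y hxy => (((Seminorm.IsRiesz.finset_sup hR s).nnreal_smul c) y x hxy).trans hx⟩
  · rw [Seminorm.mem_ball_zero, lt_div_iff₀ (by positivity)] at hx
    change (c : ℝ) * s.sup p x ≤ 1
    nlinarith [apply_nonneg (s.sup p) x]
  · have h := (c • s.sup p).convex_closedBall 0 1
    rwa [Seminorm.closedBall_zero_eq] at h

end ZeroNeighborhoods

/-! ### Comparison of the tensor seminorms with `τ_F` -/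

namespace FremlinTensor

variable {E : Type*} {F : Type*} {I : Type*} {J : Type*}
  [AddCommGroup E] [Module ℝ E] [Lattice E] [IsOrderedAddMonoid E] [IsOrderedModule ℝ E]
  [AddCommGroup F] [Module ℝ F] [Lattice F] [IsOrderedAddMonoid F]
  {p : I → Seminorm ℝ E} {q : J → Seminorm ℝ F}

/-- The finite suprema of directed families have a tensor product dominated by a finite supremum
of tensor products. The supremum on the right is over at most one index. -/
theorem exists_tensorSeminorm_finset_sup_le (hp : ∀ α, (p α).IsRiesz) (hq : ∀ β, (q β).IsRiesz)
    (hpd : SeminormFamily.IsDirected p) (hqd : SeminormFamily.IsDirected q)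
    (s : Finset I) (t : Finset J) (c d : ℝ≥0) :
    ∃ (S : Finset (I × J)) (C : ℝ), 0 ≤ C ∧ ∀ u, tensorSeminorm (c • s.sup p) (d • t.sup q) u ≤
      C * S.sup (fun k => tensorSeminorm (p k.1) (q k.2)) u := by
  have hs := Seminorm.IsRiesz.finset_sup hp s
  have ht := Seminorm.IsRiesz.finset_sup hq t
  have hcs := hs.nnreal_smul c
  have hdt := ht.nnreal_smul d
  have hc : ∀ x, (c • s.sup p) x ≤ c * s.sup p x := fun x => le_rfl
  have hd : ∀ x, (d • t.sup q) x ≤ d * t.sup q x := fun x => le_rfl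
  rcases hpd.finset_sup_le s with h | ⟨α, C, hC, h⟩
  · refine ⟨∅, 0, le_rfl, fun u => ?_⟩
    -- A zero supremum in one factor allows the constant 0 there, so the tensor seminorm vanishes
    -- and the empty `S` suffices.
    simpa using tensorSeminorm_le_mul hcs hdt hs ht le_rfl d.2 (fun x => by simp [h]) hd u
  rcases hqd.finset_sup_le t with h' | ⟨β, D, hD, h'⟩
  · refine ⟨∅, 0, le_rfl, fun u => ?_⟩
    simpa using tensorSeminorm_le_mul hcs hdt hs ht c.2 le_rfl hc (fun y => by simp [h']) u
  refine ⟨{(α, β)}, c * C * (d * D), by positivity, fun u => ?_⟩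
  rw [Finset.sup_singleton]
  refine tensorSeminorm_le_mul hcs hdt (hp α) (hq β) (by positivity) (by positivity)
    (fun x => (hc x).trans ?_) (fun y => (hd y).trans ?_) u
  · rw [mul_assoc]
    exact mul_le_mul_of_nonneg_left (h x) c.2
  · rw [mul_assoc]
    exact mul_le_mul_of_nonneg_left (h' y) d.2

/-- Each pair in `S` is dominated by the suprema over the two projections of `S`. The factor `r` is
made arbitrarily small by placing `r⁻¹` on the second seminorm. -/
theorem finset_sup_tensorSeminorm_le (hp : ∀ α, (p α).IsRiesz) (hq : ∀ β, (q β).IsRiesz)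
    (S : Finset (I × J)) {r : ℝ≥0} (hr : 0 < r) :
    ∃ (s : Finset I) (t : Finset J) (d : ℝ≥0), ∀ u,
      S.sup (fun k => tensorSeminorm (p k.1) (q k.2)) u ≤
        r * tensorSeminorm ((1 : ℝ≥0) • s.sup p) (d • t.sup q) u := by
  classical
  refine ⟨S.image Prod.fst, S.image Prod.snd, r⁻¹, fun u => ?_⟩
  refine Seminorm.finset_sup_apply_le (by positivity) fun k hk => ?_
  have h := tensorSeminorm_le_mul (hp k.1) (hq k.2)
    ((Seminorm.IsRiesz.finset_sup hp (S.image Prod.fst)).nnreal_smul 1)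
    ((Seminorm.IsRiesz.finset_sup hq (S.image Prod.snd)).nnreal_smul r⁻¹)
    (C := 1) (D := r) zero_le_one r.2 (fun x => ?_) (fun y => ?_) u
  · rwa [one_mul] at h
  · rw [one_mul, one_smul]
    exact Seminorm.le_finset_sup_apply (Finset.mem_image_of_mem _ hk)
  · rw [smul_apply, NNReal.smul_def, smul_eq_mul, NNReal.coe_inv,
      mul_inv_cancel_left₀ (by positivity)]
    exact Seminorm.le_finset_sup_apply (Finset.mem_image_of_mem _ hk)

theorem withSeminorms_tensorSeminorm [TopologicalSpace E] [TopologicalSpace F]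
    (hp : ∀ α, (p α).IsRiesz) (hq : ∀ β, (q β).IsRiesz)
    (hpE : WithSeminorms p) (hqF : WithSeminorms q)
    (hpd : SeminormFamily.IsDirected p) (hqd : SeminormFamily.IsDirected q) :
    WithSeminorms (𝕜 := ℝ) (topology := fremlinTopology E F)
      (fun k : I × J => tensorSeminorm (p k.1) (q k.2)) := by
  let P : SeminormFamily ℝ (FremlinTensor E F) (I × J) :=
    fun k => tensorSeminorm (p k.1) (q k.2)
  refine @WithSeminorms.mk _ _ _ _ _ _ _ (fremlinTopology E F) ?_
  have hP : @WithSeminorms _ _ _ _ _ _ P P.moduleFilterBasis.topology :=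
    @WithSeminorms.mk _ _ _ _ _ _ _ P.moduleFilterBasis.topology rfl
  -- Both topologies are described by translates around each point of an open set, so it suffices to
  -- fit hulls into balls and balls into hulls.
  refine TopologicalSpace.ext_iff.2 fun O => ?_
  refine Iff.trans ?_ (@WithSeminorms.isOpen_iff_mem_balls _ _ _ _ _ _
    P.moduleFilterBasis.topology _ hP O).symm
  refine forall₂_congr fun z _ => ⟨?_, ?_⟩
  · rintro ⟨U, V, hU, hV, h⟩
    obtain ⟨s, c, hs⟩ := hpE.exists_smul_finset_sup_le_one_subset hU.1
    obtain ⟨t, d, ht⟩ := hqF.exists_smul_finset_sup_le_one_subset hV.1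
    obtain ⟨S, C, hC, hS⟩ := exists_tensorSeminorm_finset_sup_le hp hq hpd hqd s t c d
    refine ⟨S, 1 / (C + 1), by positivity, fun w hw => ?_⟩
    rw [Seminorm.mem_ball, lt_div_iff₀ (by positivity)] at hw
    have hw' : w - z ∈ tensorHull U V := by
      refine tensorHull_mono hs ht (mem_unitHull_of_tensorSeminorm_lt_one ((hS _).trans_lt ?_))
      change C * S.sup P (w - z) < 1
      nlinarith [apply_nonneg (S.sup P) (w - z)]
    simpa using h _ hw'
  · rintro ⟨S, r, hr, h⟩
    obtain ⟨s, t, d, hS⟩ :=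
      -- Points of the hull have gauge at most 1, not below 1; halving `r` restores the strict
      -- inequality.
      finset_sup_tensorSeminorm_le hp hq S (r := ⟨r / 2, by positivity⟩) (half_pos hr)
    refine ⟨_, _, isConvexSolidNhd_smul_finset_sup_le_one hpE hp s 1,
      isConvexSolidNhd_smul_finset_sup_le_one hqF hq t d, fun w hw => h ?_⟩
    rw [Seminorm.mem_ball, add_sub_cancel_left]
    calc S.sup P w ≤ r / 2 * tensorSeminorm ((1 : ℝ≥0) • s.sup p) (d • t.sup q) w := hS w
      _ ≤ r / 2 * 1 :=
        mul_le_mul_of_nonneg_left (tensorSeminorm_le_one_of_mem_unitHull hw) (by positivity)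
      _ < r := by linarith

end FremlinTensor

/-- Let `E`, `F` be Archimedean vector lattices whose topologies are generated by families
`(p α)`, `(q β)` of Riesz seminorms (that is, locally convex-solid vector lattices). Then each
`W = unitHull (p α) (q β)` is absorbing, its Minkowski functional `p α ⊗ q β` is a Riesz seminorm
and is the infimum of the projective sums; if the families are directed, these seminorms generate
the topology `τ_F`. -/
theorem theorem3 {E F I J : Type*}
    [AddCommGroup E] [Module ℝ E] [Lattice E] [IsOrderedAddMonoid E] [IsOrderedModule ℝ E]
    [ArchimedeanLattice E] [TopologicalSpace E]
    [AddCommGroup F] [Module ℝ F] [Lattice F] [IsOrderedAddMonoid F] [IsOrderedModule ℝ F]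
    [ArchimedeanLattice F] [TopologicalSpace F]
    (p : I → Seminorm ℝ E) (q : J → Seminorm ℝ F)
    (hp : ∀ α, (p α).IsRiesz) (hq : ∀ β, (q β).IsRiesz)
    (hpE : WithSeminorms p) (hqF : WithSeminorms q) :
    (∀ α β, Absorbent ℝ (FremlinTensor.unitHull (p α) (q β))) ∧
    (∀ α β u, IsGLB (FremlinTensor.projectiveSums (p α) (q β) u)
      (FremlinTensor.tensorGauge (p α) (q β) u)) ∧
    ∃ P : I × J → Seminorm ℝ (FremlinTensor E F),
      (∀ α β u, P (α, β) u = FremlinTensor.tensorGauge (p α) (q β) u) ∧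
      (∀ k, (P k).IsRiesz) ∧
      (SeminormFamily.IsDirected p → SeminormFamily.IsDirected q →
        WithSeminorms (𝕜 := ℝ) (topology := FremlinTensor.fremlinTopology E F) P) := by
  exact ⟨fun α β => FremlinTensor.absorbent_unitHull _ _,
    fun α β u => FremlinTensor.isGLB_projectiveSums (hp α) (hq β) u,
    fun k => FremlinTensor.tensorSeminorm (p k.1) (q k.2), fun _ _ _ => rfl,
    fun k => FremlinTensor.isRiesz_tensorSeminorm (hp k.1) (hq k.2),
    FremlinTensor.withSeminorms_tensorSeminorm hp hq hpE hqF⟩
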